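/- Let $p$ be a polynomial with real coefficients such that $p(0)=0$ and $\lambda:=p'(0)>1$. Let $f$ be its Poincaré function at $0$, i.e. the entire function $f:\mathbb{C}\to\mathbb{C}$ with $$f(\lambda z)=p(f(z))\quad(z\in\mathbb{C}),\qquad f(0)=0,\qquad f'(0)=1.$$ Let $\mathcal{J}(p)\subset\mathbb{C}_\infty=\mathbb{C}\cup\{\infty\}$ be the Julia set of $p$, i.e. the complement in the Riemann sphere of the set of all points that have an open neighbourhood on which the sequence of iterates $(p^{(n)})_{n\in\mathbb{N}}$ is equicontinuous in the chordal metric (where $p(\infty)=\infty$). Then $$\mathcal{J}(p)\subset(-\infty,0]\iff\text{all zeros of } f \text{ are non-positive real numbers},$$ and $$\mathcal{J}(p)\subset\mathbb{R}\iff\text{all zeros of } f \text{ are real}.$$ -/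

import Mathlib

open Polynomial

/-- The chordal metric on the Riemann sphere `ℂ ∪ {∞}` (the Euclidean distance of the
stereographic projections to the unit sphere). -/
noncomputable def chordalDist : OnePoint ℂ → OnePoint ℂ → ℝ
  | OnePoint.some z, OnePoint.some w =>
      2 * ‖z - w‖ / (Real.sqrt (1 + ‖z‖ ^ 2) * Real.sqrt (1 + ‖w‖ ^ 2))
  | OnePoint.some z, OnePoint.infty => 2 / Real.sqrt (1 + ‖z‖ ^ 2)
  | OnePoint.infty, OnePoint.some w => 2 / Real.sqrt (1 + ‖w‖ ^ 2)
  | OnePoint.infty, OnePoint.infty => 0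

/-- A real (nonconstant) polynomial as a self-map of the Riemann sphere, fixing `∞`. -/
noncomputable def sphereMap (p : ℝ[X]) : OnePoint ℂ → OnePoint ℂ :=
  OnePoint.map fun z : ℂ => aeval z p

/-- The iterates of `g` are equicontinuous, in the chordal metric, at every point of `U`. -/
def IteratesEquicontinuousOn (g : OnePoint ℂ → OnePoint ℂ) (U : Set (OnePoint ℂ)) : Prop :=
  ∀ x ∈ U, ∀ ε > 0, ∃ δ > 0, ∀ y ∈ U, chordalDist x y < δ →
    ∀ n : ℕ, chordalDist (g^[n] x) (g^[n] y) < ε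

/-- The Fatou set of `p`: the points of the Riemann sphere that have an open neighbourhood on
which the iterates of `p` are equicontinuous in the chordal metric. -/
def fatouSet (p : ℝ[X]) : Set (OnePoint ℂ) :=
  {z | ∃ U : Set (OnePoint ℂ), IsOpen U ∧ z ∈ U ∧ IteratesEquicontinuousOn (sphereMap p) U}

/-- The Julia set of `p`, a subset of the Riemann sphere. -/
def juliaSet (p : ℝ[X]) : Set (OnePoint ℂ) :=
  (fatouSet p)ᶜ

/-- `f` is the Poincaré function of `p` at the fixed point `0`, i.e. the entire solution of
`f (λ z) = p (f z)`, where `λ = p'(0)`, with the normalization `f 0 = 0` and `f' 0 = 1`. -/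
structure IsPoincareFunction (p : ℝ[X]) (f : ℂ → ℂ) : Prop where
  differentiable : Differentiable ℂ f
  map_zero : f 0 = 0
  deriv_zero : deriv f 0 = 1
  map_mul : ∀ z : ℂ, f (((derivative p).eval 0 : ℝ) * z) = aeval (f z) p

open Filter Topology Set

/-! From the Julia set to the zeros: if `f z = 0`, then `f (z / λ^n)` is sent to `0` by the `n`-th
iterate of `p`. Iterated preimages of the repelling point `0` lie in the Julia set, and `λ^n * f (z
/ λ^n)` tends to `z`. Hence a closed cone containing the Julia set contains `z`
(`zero_mem_of_juliaSet_subset`).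

From the zeros to the Julia set, in degree `d ≥ 2`: every iterated preimage `w` of `0` is a value of
`f`, because an omitted one would give `f - w = exp Q` with `Q` a polynomial
(`exists_map_eq_of_iterate_eq_zero`). Writing `w = f z` makes `λ^n z` a zero of `f`, so `z` is real
when all zeros are, and then `w` is real because `f` is real on the real axis. If moreover no zero
is positive, `f` is positive and unbounded on the positive axis (`exists_lt_re`); it then takes
every positive value there, and none of these is ever mapped to `0`.

The Julia set lies in the set of bounded orbits. Suppose `z` has a bounded orbit but lies off the
real line, or on its positive half when all iterated preimages of `0` are nonpositive. Moving `z`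
halfway towards the line or towards `0` brings it closer, by a uniform factor `q < 1`, to every root
of every iterate. The `n`-th iterate of `p` has degree `d^n`, so at the new point its modulus is at
most `q^(d^n) * R`, which tends to `0`. An orbit converging to a repelling fixed point must land on
it; the new point is thus an iterated preimage of `0` in a forbidden place.

In degree one the Julia set is contained in `{0}`. -/

/-! ### Escaping and bounded orbits -/

/-- The points whose orbit under `g` stays in the closed disc of radius `R`. -/
def boundedOrbits (g : ℂ → ℂ) (R : ℝ) : Set ℂ :=
  {z | ∀ n : ℕ, ‖g^[n] z‖ ≤ R}

theorem norm_iterate_ge_of_escape {g : ℂ → ℂ} {κ R : ℝ} (hκ : 1 < κ) (hR : 0 < R)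
    (hesc : ∀ z, R ≤ ‖z‖ → κ * ‖z‖ ≤ ‖g z‖) {z : ℂ} (hz : R ≤ ‖z‖) (n : ℕ) :
    κ ^ n * ‖z‖ ≤ ‖g^[n] z‖ := by
  induction n with
  | zero => simp
  | succ n ih =>
    have h1 : R ≤ ‖g^[n] z‖ := by
      have : 1 ≤ κ ^ n := one_le_pow₀ hκ.le
      nlinarith
    rw [Function.iterate_succ_apply']
    calc κ ^ (n + 1) * ‖z‖ = κ * (κ ^ n * ‖z‖) := by ring
      _ ≤ κ * ‖g^[n] z‖ := by gcongr
      _ ≤ _ := hesc _ h1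

theorem norm_le_norm_iterate_of_escape {g : ℂ → ℂ} {κ R : ℝ} (hκ : 1 < κ) (hR : 0 < R)
    (hesc : ∀ z, R ≤ ‖z‖ → κ * ‖z‖ ≤ ‖g z‖) {z : ℂ} (hz : R ≤ ‖z‖) (n : ℕ) :
    ‖z‖ ≤ ‖g^[n] z‖ := by
  have h1 := norm_iterate_ge_of_escape hκ hR hesc hz n
  have : 1 ≤ κ ^ n := one_le_pow₀ hκ.le
  nlinarith

/-- An orbit that once leaves the disc of radius `R` grows geometrically, so it cannot return
infinitely often below any bound `B`, however large. -/
theorem mem_boundedOrbits_of_bounded {g : ℂ → ℂ} {κ R : ℝ} (hκ : 1 < κ) (hR : 0 < R)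
    (hesc : ∀ z, R ≤ ‖z‖ → κ * ‖z‖ ≤ ‖g z‖) {z : ℂ} {B : ℝ}
    (hB : ∃ᶠ n in atTop, ‖g^[n] z‖ ≤ B) : z ∈ boundedOrbits g R := by
  intro N
  by_contra! hN
  have h1 : Tendsto (fun n : ℕ => κ ^ n * R) atTop atTop :=
    (tendsto_pow_atTop_atTop_of_one_lt hκ).atTop_mul_const hR
  have h2 : ∀ᶠ n in atTop, B < κ ^ n * R := h1.eventually_gt_atTop B
  obtain ⟨M, hM⟩ := eventually_atTop.1 h2
  obtain ⟨n, hn, hnB⟩ := frequently_atTop.1 hB (N + M)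
  obtain ⟨k, rfl⟩ := Nat.exists_eq_add_of_le hn
  have h3 := norm_iterate_ge_of_escape hκ hR hesc hN.le (M + k)
  rw [← Function.iterate_add_apply, show M + k + N = N + M + k by ring] at h3
  have h4 := hM (M + k) (by omega)
  have : κ ^ (M + k) * R ≤ κ ^ (M + k) * ‖g^[N] z‖ := by gcongr
  linarith

theorem isClosed_boundedOrbits {g : ℂ → ℂ} (hg : Continuous g) (R : ℝ) :
    IsClosed (boundedOrbits g R) := by
  have : boundedOrbits g R = ⋂ n : ℕ, {z | ‖g^[n] z‖ ≤ R} := by ext; simp [boundedOrbits]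
  rw [this]
  exact isClosed_iInter fun n => isClosed_le (hg.iterate n).norm continuous_const

theorem isCompact_boundedOrbits {g : ℂ → ℂ} (hg : Continuous g) (R : ℝ) :
    IsCompact (boundedOrbits g R) :=
  (isCompact_closedBall (0 : ℂ) R).of_isClosed_subset (isClosed_boundedOrbits hg R)
    fun z hz => by simpa using hz 0

/-! ### The chordal metric and equicontinuity off the bounded orbits -/

theorem sphereMap_iterate_coe (p : ℝ[X]) (n : ℕ) (z : ℂ) :
    (sphereMap p)^[n] (z : OnePoint ℂ) = (((fun z : ℂ => aeval z p)^[n] z : ℂ) : OnePoint ℂ) := by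
  induction n with
  | zero => rfl
  | succ n ih => rw [Function.iterate_succ_apply', Function.iterate_succ_apply', ih]; rfl

theorem sphereMap_iterate_infty (p : ℝ[X]) (n : ℕ) :
    (sphereMap p)^[n] OnePoint.infty = OnePoint.infty :=
  Function.iterate_fixed rfl n

theorem chordalDist_coe_coe (z w : ℂ) : chordalDist (z : OnePoint ℂ) (w : OnePoint ℂ) =
    2 * ‖z - w‖ / (Real.sqrt (1 + ‖z‖ ^ 2) * Real.sqrt (1 + ‖w‖ ^ 2)) := rfl

theorem chordalDist_coe_infty (z : ℂ) :
    chordalDist (z : OnePoint ℂ) OnePoint.infty = 2 / Real.sqrt (1 + ‖z‖ ^ 2) := rfl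

theorem chordalDist_infty_coe (z : ℂ) :
    chordalDist OnePoint.infty (z : OnePoint ℂ) = 2 / Real.sqrt (1 + ‖z‖ ^ 2) := rfl

theorem one_le_sqrt_one_add_sq (x : ℝ) : 1 ≤ √(1 + x ^ 2) :=
  Real.one_le_sqrt.2 (by nlinarith [sq_nonneg x])

theorem le_sqrt_one_add_sq (x : ℝ) : x ≤ √(1 + x ^ 2) :=
  Real.le_sqrt_of_sq_le (by linarith)

theorem sqrt_one_add_sq_le {x : ℝ} (hx : 0 ≤ x) : √(1 + x ^ 2) ≤ 1 + x :=
  Real.sqrt_le_iff.2 ⟨by linarith, by nlinarith⟩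

theorem chordalDist_coe_le (z w : ℂ) :
    chordalDist (z : OnePoint ℂ) (w : OnePoint ℂ) ≤ 2 * ‖z - w‖ := by
  rw [chordalDist_coe_coe]
  apply div_le_self (by positivity)
  have h1 := one_le_sqrt_one_add_sq ‖z‖
  have h2 := one_le_sqrt_one_add_sq ‖w‖
  nlinarith

theorem chordalDist_coe_le_of_large {z w : ℂ} {T : ℝ} (hT : 0 < T) (hz : T ≤ ‖z‖) (hw : T ≤ ‖w‖) :
    chordalDist (z : OnePoint ℂ) (w : OnePoint ℂ) ≤ 4 / T := by
  rw [chordalDist_coe_coe]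
  have h1 := le_sqrt_one_add_sq ‖z‖
  have h2 := le_sqrt_one_add_sq ‖w‖
  set a := √(1 + ‖z‖ ^ 2)
  set b := √(1 + ‖w‖ ^ 2)
  have ha : T ≤ a := hz.trans h1
  have hb : T ≤ b := hw.trans h2
  have h0 : ‖z - w‖ ≤ a + b := (norm_sub_le z w).trans (by linarith)
  rw [div_le_div_iff₀ (by nlinarith) hT]
  have : T * a ≤ a * b := by nlinarith
  have : T * b ≤ a * b := by nlinarith
  nlinarith

/-- Points that are chordally close to a finite point are finite and close to it. -/
theorem exists_norm_sub_le_of_chordalDist_lt {x : ℂ} {y : OnePoint ℂ} {δ : ℝ}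
    (hδ : δ * (1 + ‖x‖) ≤ 1) (h : chordalDist (x : OnePoint ℂ) y < δ) :
    ∃ w : ℂ, y = w ∧ ‖x - w‖ ≤ δ * (1 + ‖x‖) ^ 2 := by
  have h1 := one_le_sqrt_one_add_sq ‖x‖
  have h2 := sqrt_one_add_sq_le (norm_nonneg x)
  induction y using OnePoint.rec with
  | infty =>
    rw [chordalDist_coe_infty, div_lt_iff₀ (by linarith)] at h
    exfalso
    have hδ0 : 0 < δ := by
      by_contra! h0
      nlinarith
    have : δ * √(1 + ‖x‖ ^ 2) ≤ δ * (1 + ‖x‖) := by gcongr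
    linarith
  | coe w =>
    refine ⟨w, rfl, ?_⟩
    have h3 := one_le_sqrt_one_add_sq ‖w‖
    have h4 := sqrt_one_add_sq_le (norm_nonneg w)
    have h5 : ‖w‖ ≤ ‖x‖ + ‖x - w‖ := by
      have := norm_sub_norm_le w x
      rw [norm_sub_rev] at this
      linarith
    rw [chordalDist_coe_coe, div_lt_iff₀ (by positivity)] at h
    have hδ0 : 0 < δ := by
      by_contra! h0
      have : δ * (√(1 + ‖x‖ ^ 2) * √(1 + ‖w‖ ^ 2)) ≤ 0 :=
        mul_nonpos_of_nonpos_of_nonneg h0 (by positivity)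
      linarith [norm_nonneg (x - w)]
    have h6 : √(1 + ‖x‖ ^ 2) * √(1 + ‖w‖ ^ 2) ≤ (1 + ‖x‖) * (1 + ‖x‖ + ‖x - w‖) := by
      gcongr
      linarith
    have h7 : δ * (√(1 + ‖x‖ ^ 2) * √(1 + ‖w‖ ^ 2)) ≤
      δ * ((1 + ‖x‖) * (1 + ‖x‖ + ‖x - w‖)) := by gcongr
    -- The hypothesis `hδ` lets one of the two copies of `‖x - w‖` on the left of `h` absorb this
    -- term.
    have h8 : δ * (1 + ‖x‖) * ‖x - w‖ ≤ 1 * ‖x - w‖ := by gcongr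
    nlinarith

/-- Near an escaping point all orbits become uniformly large, hence chordally close to each other,
after finitely many steps; continuity handles those steps. The rate `κ` is left free because the
linear case escapes only at rate `λ`. -/
theorem compl_boundedOrbits_subset_fatouSet {p : ℝ[X]} {κ R : ℝ} (hκ : 1 < κ) (hR : 0 < R)
    (hesc : ∀ z : ℂ, R ≤ ‖z‖ → κ * ‖z‖ ≤ ‖aeval z p‖) :
    ((↑) '' boundedOrbits (fun z => aeval z p) R : Set (OnePoint ℂ))ᶜ ⊆ fatouSet p := by
  set g : ℂ → ℂ := fun z => aeval z p with hg_def
  have hg : Continuous g := p.continuous_aeval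
  intro z hz
  refine ⟨_, OnePoint.isOpen_compl_image_coe.2
    ⟨isClosed_boundedOrbits hg R, isCompact_boundedOrbits hg R⟩, hz, ?_⟩
  intro x hx ε hε
  induction x using OnePoint.rec with
  | infty =>
    have hR2 := one_le_sqrt_one_add_sq R
    -- The second bound is the chordal distance from `∞` to the circle of radius `R`: it forces `‖w‖
    -- > R`, after which the orbit never gets farther from `∞` than `w`.
    refine ⟨min ε (2 / √(1 + R ^ 2)), by positivity, fun y _ hxy n => ?_⟩
    rw [lt_min_iff] at hxy
    induction y using OnePoint.rec with
    | infty => rw [sphereMap_iterate_infty]; simpa [chordalDist] using hε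
    | coe w =>
      rw [sphereMap_iterate_infty, sphereMap_iterate_coe]
      rw [chordalDist_infty_coe] at hxy ⊢
      refine lt_of_le_of_lt ?_ hxy.1
      have h1 := hxy.2
      rw [div_lt_div_iff_of_pos_left two_pos (by positivity) (by positivity),
        Real.sqrt_lt_sqrt_iff (by positivity)] at h1
      have hw : R ≤ ‖w‖ := le_of_lt (lt_of_pow_lt_pow_left₀ 2 (norm_nonneg _) (by linarith))
      have := norm_le_norm_iterate_of_escape hκ hR hesc hw n
      gcongr
  | coe x =>
    have hxK : x ∉ boundedOrbits g R := fun h => hx ⟨x, h, rfl⟩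
    obtain ⟨N, hN⟩ : ∃ N : ℕ, R < ‖g^[N] x‖ := by
      simpa [boundedOrbits] using hxK
    have hev : ∀ᶠ y in 𝓝 x, R < ‖g^[N] y‖ :=
      ((hg.iterate N).norm.tendsto x).eventually (lt_mem_nhds hN)
    obtain ⟨M, hM⟩ : ∃ M : ℕ, 4 / (κ ^ M * R) < ε := by
      have h1 : Tendsto (fun n : ℕ => 4 / (κ ^ n * R)) atTop (𝓝 0) :=
        ((tendsto_pow_atTop_atTop_of_one_lt hκ).atTop_mul_const hR).const_div_atTop 4
      exact (h1.eventually (gt_mem_nhds hε)).exists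
    have hev2 : ∀ᶠ y in 𝓝 x, ∀ n < N + M, ‖g^[n] x - g^[n] y‖ < ε / 2 := by
      refine (eventually_all_finite (Set.finite_Iio (N + M))).2 fun n _ => ?_
      have h1 : ContinuousAt (fun y => ‖g^[n] x - g^[n] y‖) x :=
        (continuous_const.sub (hg.iterate n)).norm.continuousAt
      exact h1.eventually_lt continuousAt_const (by simpa using hε)
    have hev3 : ∀ᶠ y in 𝓝 x, ∀ n : ℕ,
        chordalDist (g^[n] x : ℂ) (g^[n] y : ℂ) < ε := by
      filter_upwards [hev, hev2] with y hy hy2 n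
      rcases lt_or_ge n (N + M) with hn | hn
      · exact (chordalDist_coe_le _ _).trans_lt (by linarith [hy2 n hn])
      · obtain ⟨k, rfl⟩ := Nat.exists_eq_add_of_le hn
        have key : ∀ u : ℂ, R < ‖g^[N] u‖ → κ ^ M * R ≤ ‖g^[N + M + k] u‖ := by
          intro u hu
          have h3 := norm_iterate_ge_of_escape hκ hR hesc hu.le (M + k)
          rw [← Function.iterate_add_apply, show M + k + N = N + M + k by ring] at h3
          refine le_trans ?_ h3
          gcongr
          · exact hκ.le
          · omega
        exact (chordalDist_coe_le_of_large (by positivity) (key x hN) (key y hy)).trans_lt hM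
    obtain ⟨η, hη, hball⟩ := Metric.eventually_nhds_iff.1 hev3
    have hx1 : 0 < 1 + ‖x‖ := by positivity
    -- The first bound excludes `y = ∞`; the second turns chordal closeness into Euclidean distance
    -- less than `η`.
    refine ⟨min (1 / (1 + ‖x‖)) (η / 2 / (1 + ‖x‖) ^ 2), by positivity, fun y _ hxy n => ?_⟩
    obtain ⟨w, rfl, hw⟩ := exists_norm_sub_le_of_chordalDist_lt
      ((mul_le_mul_of_nonneg_right (min_le_left _ _) hx1.le).trans (by field_simp; rfl)) hxy
    rw [sphereMap_iterate_coe, sphereMap_iterate_coe]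
    apply hball
    rw [dist_comm, dist_eq_norm]
    refine hw.trans_lt ?_
    calc _ ≤ η / 2 / (1 + ‖x‖) ^ 2 * (1 + ‖x‖) ^ 2 := by gcongr; exact min_le_right _ _
      _ = η / 2 := by field_simp
      _ < η := by linarith

theorem juliaSet_subset_boundedOrbits {p : ℝ[X]} {κ R : ℝ} (hκ : 1 < κ) (hR : 0 < R)
    (hesc : ∀ z : ℂ, R ≤ ‖z‖ → κ * ‖z‖ ≤ ‖aeval z p‖) :
    juliaSet p ⊆ (↑) '' boundedOrbits (fun z => aeval z p) R :=
  compl_subset_comm.1 (compl_boundedOrbits_subset_fatouSet hκ hR hesc)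

/-! ### Behaviour near infinity and near the repelling fixed point -/

theorem exists_escape_radius {P : ℂ[X]} (hP0 : P.eval 0 = 0) (hd : 2 ≤ P.natDegree) :
    ∃ R : ℝ, 0 < R ∧ ∀ z : ℂ, R ≤ ‖z‖ → 2 * ‖z‖ ≤ ‖P.eval z‖ := by
  have h1 : Tendsto (fun z : ℂ => ‖P.divX.eval z‖) (Bornology.cobounded ℂ) atTop := by
    apply Polynomial.tendsto_norm_atTop _ _ tendsto_norm_cobounded_atTop
    rw [← natDegree_pos_iff_degree_pos, natDegree_divX_eq_natDegree_tsub_one]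
    omega
  have h2 := h1.eventually_ge_atTop 2
  rw [← comap_norm_atTop, eventually_comap, eventually_atTop] at h2
  obtain ⟨R, hR⟩ := h2
  refine ⟨max R 1, by positivity, fun z hz => ?_⟩
  have h3 := hR ‖z‖ ((le_max_left _ _).trans hz) z rfl
  have h4 : P.eval z = P.divX.eval z * z := by
    conv_lhs => rw [← divX_mul_X_add P]
    simp [coeff_zero_eq_eval_zero, hP0]
  rw [h4, norm_mul]
  gcongr

theorem exists_norm_le_norm_eval_of_repelling {P : ℂ[X]} (hP0 : P.eval 0 = 0)
    (hP1 : 1 < ‖(derivative P).eval 0‖) : ∃ r : ℝ, 0 < r ∧ ∀ z : ℂ, ‖z‖ ≤ r → ‖z‖ ≤ ‖P.eval z‖ := by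
  have h0 : P.divX.eval 0 = (derivative P).eval 0 := by
    rw [← coeff_zero_eq_eval_zero, ← coeff_zero_eq_eval_zero, coeff_divX, coeff_derivative]
    simp
  have h1 : ∀ᶠ z in 𝓝 (0 : ℂ), 1 < ‖P.divX.eval z‖ :=
    P.divX.continuous.norm.continuousAt.eventually (lt_mem_nhds (by simpa [h0] using hP1))
  obtain ⟨r, hr, h⟩ := Metric.eventually_nhds_iff.1 h1
  refine ⟨r / 2, by positivity, fun z hz => ?_⟩
  have h3 : 1 < ‖P.divX.eval z‖ := h (by rw [dist_zero_right]; linarith)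
  have h4 : P.eval z = P.divX.eval z * z := by
    conv_lhs => rw [← divX_mul_X_add P]
    simp [coeff_zero_eq_eval_zero, hP0]
  rw [h4, norm_mul]
  nlinarith [norm_nonneg z]

/-- Once the orbit stays in the disc of radius `r`, its norms no longer decrease, so they can tend
to `0` only by being `0`. -/
theorem exists_iterate_eq_zero_of_tendsto {g : ℂ → ℂ} {r : ℝ} (hr : 0 < r)
    (hg : ∀ z, ‖z‖ ≤ r → ‖z‖ ≤ ‖g z‖) {z : ℂ}
    (hz : Tendsto (fun n : ℕ => g^[n] z) atTop (𝓝 0)) : ∃ N : ℕ, g^[N] z = 0 := by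
  have hz' := hz.norm
  rw [norm_zero] at hz'
  obtain ⟨N, hN⟩ := eventually_atTop.1 (hz'.eventually (ge_mem_nhds hr))
  have hmono : ∀ k : ℕ, ‖g^[N] z‖ ≤ ‖g^[N + k] z‖ := by
    intro k
    induction k with
    | zero => rfl
    | succ k ih =>
      refine ih.trans ?_
      rw [← add_assoc, Function.iterate_succ_apply']
      exact hg _ (hN _ (by omega))
  refine ⟨N, norm_le_zero_iff.1 (ge_of_tendsto hz' ?_)⟩
  filter_upwards [eventually_ge_atTop N] with n hn
  obtain ⟨k, rfl⟩ := Nat.exists_eq_add_of_le hn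
  exact hmono k

/-! ### Comparing values of iterates through distances to their roots -/

theorem norm_eval_eq_prod_roots (Q : ℂ[X]) (z : ℂ) :
    ‖Q.eval z‖ = ‖Q.leadingCoeff‖ * (Q.roots.map fun r => ‖z - r‖).prod := by
  rw [(IsAlgClosed.splits Q).eval_eq_prod_roots, norm_mul]
  congr 1
  exact (Multiset.prod_hom' Q.roots (normHom : ℂ →*₀ ℝ) fun r => z - r).symm

theorem norm_eval_le_pow_natDegree_mul {Q : ℂ[X]} {z w : ℂ} {q : ℝ}
    (h : ∀ r, Q.eval r = 0 → ‖w - r‖ ≤ q * ‖z - r‖) :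
    ‖Q.eval w‖ ≤ q ^ Q.natDegree * ‖Q.eval z‖ := by
  have h1 : (Q.roots.map fun r => ‖w - r‖).prod ≤ (Q.roots.map fun r => q * ‖z - r‖).prod :=
    Multiset.prod_map_le_prod_map₀ _ _ (fun _ _ => norm_nonneg _)
      fun r hr => h r (isRoot_of_mem_roots hr)
  rw [Multiset.prod_map_mul, Multiset.map_const', Multiset.prod_replicate,
    ← (IsAlgClosed.splits Q).natDegree_eq_card_roots] at h1
  rw [norm_eval_eq_prod_roots, norm_eval_eq_prod_roots]
  calc _ ≤ ‖Q.leadingCoeff‖ * (q ^ Q.natDegree * (Q.roots.map fun r => ‖z - r‖).prod) := by gcongr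
    _ = _ := by ring

theorem norm_eval_mul_norm_eval_le_pow_natDegree_mul {Q : ℂ[X]} {a b m : ℂ} {q : ℝ}
    (h : ∀ r, Q.eval r = 0 → ‖a - r‖ * ‖b - r‖ ≤ q * (‖m - r‖ * ‖m - r‖)) :
    ‖Q.eval a‖ * ‖Q.eval b‖ ≤ q ^ Q.natDegree * (‖Q.eval m‖ * ‖Q.eval m‖) := by
  have h1 : (Q.roots.map fun r => ‖a - r‖ * ‖b - r‖).prod ≤
      (Q.roots.map fun r => q * (‖m - r‖ * ‖m - r‖)).prod :=
    Multiset.prod_map_le_prod_map₀ _ _ (fun _ _ => by positivity)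
      fun r hr => h r (isRoot_of_mem_roots hr)
  rw [Multiset.prod_map_mul, Multiset.prod_map_mul, Multiset.prod_map_mul, Multiset.map_const',
    Multiset.prod_replicate, ← (IsAlgClosed.splits Q).natDegree_eq_card_roots] at h1
  simp only [norm_eval_eq_prod_roots Q]
  have := mul_le_mul_of_nonneg_left h1 (by positivity : 0 ≤ ‖Q.leadingCoeff‖ * ‖Q.leadingCoeff‖)
  linarith

theorem tendsto_pow_pow_atTop_nhds_zero {q : ℝ} (hq0 : 0 ≤ q) (hq1 : q < 1) {d : ℕ} (hd : 2 ≤ d) :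
    Tendsto (fun n : ℕ => q ^ d ^ n) atTop (𝓝 0) :=
  (tendsto_pow_atTop_nhds_zero_of_lt_one hq0 hq1).comp
    (tendsto_pow_atTop_atTop_of_one_lt (by omega))

theorem eval_iterate_comp_X (P : ℂ[X]) (n : ℕ) (z : ℂ) :
    (P.comp^[n] X).eval z = (fun z => P.eval z)^[n] z := by
  simp

/-- The `n`-th iterate has `d ^ n` roots with multiplicity, so a gain of `q` per root becomes `q ^ d
^ n`, against values at `z` bounded by `R`. -/
theorem tendsto_iterate_eval_zero {P : ℂ[X]} (hd : 2 ≤ P.natDegree) {R : ℝ} {z w : ℂ} {q : ℝ}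
    (hq0 : 0 ≤ q) (hq1 : q < 1)
    (h : ∀ n r, (fun z => P.eval z)^[n] r = 0 → ‖w - r‖ ≤ q * ‖z - r‖)
    (hz : z ∈ boundedOrbits (fun z => P.eval z) R) :
    Tendsto (fun n : ℕ => (fun z => P.eval z)^[n] w) atTop (𝓝 0) := by
  rw [tendsto_zero_iff_norm_tendsto_zero]
  have h1 := (tendsto_pow_pow_atTop_nhds_zero hq0 hq1 hd).mul_const R
  rw [zero_mul] at h1
  refine squeeze_zero (fun _ => norm_nonneg _) (fun n => ?_) h1
  have h2 := norm_eval_le_pow_natDegree_mul (Q := P.comp^[n] X) (z := z) (w := w) (q := q)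
    fun r hr => h n r (by rwa [eval_iterate_comp_X] at hr)
  rw [eval_iterate_comp_X, eval_iterate_comp_X, natDegree_iterate_comp, natDegree_X, mul_one] at h2
  refine h2.trans ?_
  gcongr
  exact hz n

/-- The two-point version: a root may be farther from `a` or from `b` than from `m`, and only the
product of the distances need be smaller. -/
theorem tendsto_norm_iterate_eval_mul_zero {P : ℂ[X]} (hd : 2 ≤ P.natDegree) {R : ℝ} {a b m : ℂ}
    {q : ℝ} (hq0 : 0 ≤ q) (hq1 : q < 1)
    (h : ∀ n r, (fun z => P.eval z)^[n] r = 0 → ‖a - r‖ * ‖b - r‖ ≤ q * (‖m - r‖ * ‖m - r‖))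
    (hm : m ∈ boundedOrbits (fun z => P.eval z) R) :
    Tendsto (fun n : ℕ => ‖(fun z => P.eval z)^[n] a‖ * ‖(fun z => P.eval z)^[n] b‖)
      atTop (𝓝 0) := by
  have h1 := (tendsto_pow_pow_atTop_nhds_zero hq0 hq1 hd).mul_const (R * R)
  rw [zero_mul] at h1
  refine squeeze_zero (fun _ => by positivity) (fun n => ?_) h1
  have h2 := norm_eval_mul_norm_eval_le_pow_natDegree_mul (Q := P.comp^[n] X)
    (a := a) (b := b) (m := m) (q := q) fun r hr => h n r (by rwa [eval_iterate_comp_X] at hr)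
  rw [eval_iterate_comp_X, eval_iterate_comp_X, eval_iterate_comp_X, natDegree_iterate_comp,
    natDegree_X, mul_one] at h2
  refine h2.trans ?_
  have h3 := hm n
  gcongr
  exact (norm_nonneg _).trans h3

/-! ### Location of bounded orbits from the iterated preimages of `0` -/

theorem iterate_eq_zero_of_le {g : ℂ → ℂ} (hg0 : g 0 = 0) {z : ℂ} {n m : ℕ} (h : g^[n] z = 0)
    (hnm : n ≤ m) : g^[m] z = 0 := by
  obtain ⟨k, rfl⟩ := Nat.exists_eq_add_of_le' hnm
  rw [Function.iterate_add_apply, h, Function.iterate_fixed hg0]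

theorem norm_le_of_iterate_eq_zero {g : ℂ → ℂ} {κ R : ℝ} (hκ : 1 < κ) (hR : 0 < R)
    (hesc : ∀ z, R ≤ ‖z‖ → κ * ‖z‖ ≤ ‖g z‖) (hg0 : g 0 = 0) {z : ℂ} {n : ℕ}
    (hz : g^[n] z = 0) : ‖z‖ ≤ R := by
  refine mem_boundedOrbits_of_bounded hκ hR hesc (B := 0) (z := z) ?_ 0
  refine Eventually.frequently ?_
  filter_upwards [eventually_ge_atTop n] with m hm
  rw [iterate_eq_zero_of_le hg0 hz hm, norm_zero]

/-- If all iterated preimages of the repelling fixed point `0` are real, then bounded orbits start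
at real points. -/
theorem im_eq_zero_of_mem_boundedOrbits {P : ℂ[X]} (hP0 : P.eval 0 = 0)
    (hP1 : 1 < ‖(derivative P).eval 0‖) (hd : 2 ≤ P.natDegree) {κ R : ℝ} (hκ : 1 < κ) (hR : 0 < R)
    (hesc : ∀ z : ℂ, R ≤ ‖z‖ → κ * ‖z‖ ≤ ‖P.eval z‖)
    (hreal : ∀ (n : ℕ) (r : ℂ), (fun z => P.eval z)^[n] r = 0 → r.im = 0) {z : ℂ}
    (hz : z ∈ boundedOrbits (fun z => P.eval z) R) : z.im = 0 := by
  by_contra hy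
  set D : ℝ := (|z.re| + R) ^ 2 + z.im ^ 2 with hD
  have hy2 : 0 < z.im ^ 2 := by positivity
  have hDpos : 0 < D := by positivity
  have hyD : z.im ^ 2 / D ≤ 1 := (div_le_one hDpos).2 (by rw [hD]; nlinarith [sq_nonneg (|z.re| + R)])
  have hyD0 : 0 < z.im ^ 2 / D := by positivity
  obtain ⟨r₀, hr₀, hrep⟩ := exists_norm_le_norm_eval_of_repelling hP0 hP1
  -- Halving the imaginary part lowers each squared distance to a real root by `3 / 4 * z.im ^ 2`,
  -- while that squared distance is at most `D`.
  suffices h : Tendsto (fun n : ℕ => (fun z => P.eval z)^[n] ⟨z.re, z.im / 2⟩) atTop (𝓝 0) by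
    obtain ⟨N, hN⟩ := exists_iterate_eq_zero_of_tendsto hr₀ hrep h
    have := hreal N _ hN
    simp at this
    exact hy this
  refine tendsto_iterate_eval_zero hd (Real.sqrt_nonneg (1 - 3 / 4 * (z.im ^ 2 / D)))
    ((Real.sqrt_lt' one_pos).2 (by linarith)) (fun n r hr => ?_) hz
  · have hr1 := norm_le_of_iterate_eq_zero hκ hR hesc hP0 hr
    have hr2 := hreal n r hr
    have hr3 : |r.re| ≤ R := (Complex.abs_re_le_norm r).trans hr1
    refine le_of_sq_le_sq ?_ (by positivity)
    rw [mul_pow, Real.sq_sqrt (by linarith), Complex.sq_norm, Complex.sq_norm,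
      Complex.normSq_apply, Complex.normSq_apply]
    simp only [Complex.sub_re, Complex.sub_im, hr2, sub_zero]
    have h1 : (z.re - r.re) ^ 2 ≤ (|z.re| + R) ^ 2 :=
      sq_le_sq' (by linarith [neg_abs_le z.re, neg_abs_le r.re, le_abs_self r.re])
        (by linarith [le_abs_self z.re, neg_abs_le r.re])
    have h2 : z.im ^ 2 / D * ((z.re - r.re) ^ 2 + z.im ^ 2) ≤ z.im ^ 2 := by
      calc _ ≤ z.im ^ 2 / D * D := by gcongr; rw [hD]; gcongr
        _ = _ := by field_simp
    nlinarith

/-- If all iterated preimages of the repelling fixed point `0` are nonpositive real numbers, then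
bounded orbits start at nonpositive real numbers. -/
theorem re_nonpos_of_mem_boundedOrbits {P : ℂ[X]} (hP0 : P.eval 0 = 0)
    (hP1 : 1 < ‖(derivative P).eval 0‖) (hd : 2 ≤ P.natDegree) {κ R : ℝ} (hκ : 1 < κ) (hR : 0 < R)
    (hesc : ∀ z : ℂ, R ≤ ‖z‖ → κ * ‖z‖ ≤ ‖P.eval z‖)
    (hreal : ∀ (n : ℕ) (r : ℂ), (fun z => P.eval z)^[n] r = 0 → r.im = 0)
    (hnonpos : ∀ (n : ℕ) (r : ℂ), (fun z => P.eval z)^[n] r = 0 → r.re ≤ 0) {z : ℂ}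
    (hz : z ∈ boundedOrbits (fun z => P.eval z) R) : z.re ≤ 0 := by
  have hzim := im_eq_zero_of_mem_boundedOrbits hP0 hP1 hd hκ hR hesc hreal hz
  by_contra! hx
  have hq : z.re / (z.re + R) < 1 := (div_lt_one (by positivity)).2 (by linarith)
  have hq0 : 0 < z.re / (z.re + R) := by positivity
  obtain ⟨r₀, hr₀, hrep⟩ := exists_norm_le_norm_eval_of_repelling hP0 hP1
  -- Halving `z` shortens the distance `z.re - r.re ≤ z.re + R` to each root by `z.re / 2`.
  suffices h : Tendsto (fun n : ℕ => (fun z => P.eval z)^[n] ⟨z.re / 2, 0⟩) atTop (𝓝 0) by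
    obtain ⟨N, hN⟩ := exists_iterate_eq_zero_of_tendsto hr₀ hrep h
    have := hnonpos N _ hN
    simp at this
    linarith
  refine tendsto_iterate_eval_zero (q := 1 - z.re / (z.re + R) / 2) hd
    (by linarith) (by linarith) (fun n r hr => ?_) hz
  · have hr1 := norm_le_of_iterate_eq_zero hκ hR hesc hP0 hr
    have hr2 := hreal n r hr
    have hr0 := hnonpos n r hr
    have hr3 : |r.re| ≤ R := (Complex.abs_re_le_norm r).trans hr1
    rw [abs_of_nonpos hr0] at hr3
    have hnorm : ∀ w : ℂ, w.im = 0 → 0 ≤ w.re → ‖w - r‖ = w.re - r.re := by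
      intro w hw hw0
      have h1 : (w - r).im = 0 := by simp [hw, hr2]
      rw [← Complex.abs_re_eq_norm.2 h1, Complex.sub_re, abs_of_nonneg (by linarith)]
    rw [hnorm _ rfl (by simp only; linarith), hnorm z hzim hx.le]
    have h2 : z.re / (z.re + R) * (z.re - r.re) ≤ z.re := by
      calc _ ≤ z.re / (z.re + R) * (z.re + R) := by gcongr; linarith
        _ = _ := by field_simp
    simp only
    linarith

/-! ### Iterating the functional equation; linearization at `0` -/

theorem IsPoincareFunction.map_pow_mul {p : ℝ[X]} {f : ℂ → ℂ} (hf : IsPoincareFunction p f)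
    (n : ℕ) (z : ℂ) :
    f ((((derivative p).eval 0 : ℝ) : ℂ) ^ n * z) = (fun z => aeval z p)^[n] (f z) := by
  induction n with
  | zero => simp
  | succ n ih => rw [pow_succ', mul_assoc, hf.map_mul, ih, Function.iterate_succ_apply']

theorem IsPoincareFunction.iterate_map_div {p : ℝ[X]} {f : ℂ → ℂ} (hf : IsPoincareFunction p f)
    (hp1 : 1 < (derivative p).eval 0) (n : ℕ) (z : ℂ) :
    (fun z => aeval z p)^[n] (f (z / (((derivative p).eval 0 : ℝ) : ℂ) ^ n)) = f z := by
  have : (((derivative p).eval 0 : ℝ) : ℂ) ≠ 0 := by exact_mod_cast (by linarith)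
  rw [← hf.map_pow_mul]
  congr 1
  field_simp

theorem tendsto_div_ofReal_pow {l : ℝ} (hl : 1 < l) (z : ℂ) :
    Tendsto (fun n : ℕ => z / (l : ℂ) ^ n) atTop (𝓝 0) := by
  rw [tendsto_zero_iff_norm_tendsto_zero]
  simp only [norm_div, norm_pow, Complex.norm_real, Real.norm_of_nonneg (by linarith : 0 ≤ l)]
  exact (tendsto_pow_atTop_atTop_of_one_lt hl).const_div_atTop _

theorem IsPoincareFunction.hasDerivAt_zero {p : ℝ[X]} {f : ℂ → ℂ} (hf : IsPoincareFunction p f) :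
    HasDerivAt f 1 0 :=
  hf.deriv_zero ▸ (hf.differentiable 0).hasDerivAt

theorem IsPoincareFunction.tendsto_map_div {p : ℝ[X]} {f : ℂ → ℂ} (hf : IsPoincareFunction p f)
    (hp1 : 1 < (derivative p).eval 0) (z : ℂ) :
    Tendsto (fun n : ℕ => f (z / (((derivative p).eval 0 : ℝ) : ℂ) ^ n)) atTop (𝓝 0) := by
  have h := (hf.differentiable.continuous.tendsto 0).comp (tendsto_div_ofReal_pow hp1 z)
  rwa [hf.map_zero] at h

theorem IsPoincareFunction.tendsto_pow_mul_map_div {p : ℝ[X]} {f : ℂ → ℂ}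
    (hf : IsPoincareFunction p f) (hp1 : 1 < (derivative p).eval 0) (z : ℂ) :
    Tendsto (fun n : ℕ => (((derivative p).eval 0 : ℝ) : ℂ) ^ n *
      f (z / (((derivative p).eval 0 : ℝ) : ℂ) ^ n)) atTop (𝓝 z) := by
  have hl : (((derivative p).eval 0 : ℝ) : ℂ) ≠ 0 := by exact_mod_cast (by linarith)
  rcases eq_or_ne z 0 with rfl | hz
  · simp [hf.map_zero]
  have h1 := hf.hasDerivAt_zero.tendsto_slope_zero
  have h2 : Tendsto (fun n : ℕ => z / (((derivative p).eval 0 : ℝ) : ℂ) ^ n) atTop (𝓝[≠] 0) :=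
    tendsto_nhdsWithin_iff.2 ⟨tendsto_div_ofReal_pow hp1 z,
      Eventually.of_forall fun n => div_ne_zero hz (pow_ne_zero n hl)⟩
  have h3 := (h1.comp h2).const_mul z
  rw [mul_one] at h3
  refine h3.congr fun n => ?_
  simp only [Function.comp_apply, zero_add, hf.map_zero, sub_zero, smul_eq_mul]
  field_simp

theorem IsPoincareFunction.not_const {p : ℝ[X]} {f : ℂ → ℂ} (hf : IsPoincareFunction p f) (c : ℂ) :
    ¬ ∀ z, f z = c := by
  intro h
  have := hf.deriv_zero
  rw [show f = fun _ => c from funext h, deriv_const] at this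
  exact zero_ne_one this

/-! ### From the Julia set to the zeros of `f` -/

theorem IsPoincareFunction.isOpenMap {p : ℝ[X]} {f : ℂ → ℂ} (hf : IsPoincareFunction p f)
    (hp1 : 1 < (derivative p).eval 0) : IsOpenMap fun z : ℂ => aeval z p := by
  have hl : (((derivative p).eval 0 : ℝ) : ℂ) ≠ 0 := by exact_mod_cast (by linarith)
  have hd : Differentiable ℂ fun z : ℂ => aeval z p := p.differentiable_aeval
  refine (AnalyticOnNhd.is_constant_or_isOpenMap
    fun z _ => hd.analyticAt z).resolve_left ?_
  rintro ⟨c, hc⟩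
  refine hf.not_const c fun z => ?_
  rw [← hc (f (z / (((derivative p).eval 0 : ℝ) : ℂ))), ← hf.map_mul]
  congr 1
  field_simp

theorem isOpenMap_iterate {α : Type*} [TopologicalSpace α] {g : α → α} (hg : IsOpenMap g) (n : ℕ) :
    IsOpenMap g^[n] := by
  induction n with
  | zero => exact IsOpenMap.id
  | succ n ih => exact ih.comp hg

theorem chordalDist_zero_pos {c : ℂ} (hc : c ≠ 0) :
    0 < chordalDist ((0 : ℂ) : OnePoint ℂ) (c : OnePoint ℂ) := by
  rw [chordalDist_coe_coe, zero_sub, norm_neg]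
  have := norm_pos_iff.2 hc
  positivity

/-- Iterated preimages of the repelling fixed point `0` lie in the Julia set. -/
theorem IsPoincareFunction.mem_juliaSet_of_iterate_eq_zero {p : ℝ[X]} {f : ℂ → ℂ}
    (hf : IsPoincareFunction p f) (hp1 : 1 < (derivative p).eval 0) {n : ℕ} {w : ℂ}
    (hw : (fun z => aeval z p)^[n] w = 0) : (w : OnePoint ℂ) ∈ juliaSet p := by
  rintro ⟨U, hU, hwU, hequi⟩
  set g : ℂ → ℂ := fun z => aeval z p with hg_def
  have hg0 : g 0 = 0 := by
    have := hf.map_mul 0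
    rw [mul_zero, hf.map_zero] at this
    exact this.symm
  obtain ⟨k, hk⟩ : ∃ k, f k ≠ 0 := by simpa using hf.not_const 0
  obtain ⟨δ, hδ, hequi⟩ := hequi _ hwU _ (chordalDist_zero_pos hk)
  have hV : {y : ℂ | (y : OnePoint ℂ) ∈ U ∧ ‖w - y‖ < δ / 2} ∈ 𝓝 w := by
    refine inter_mem (OnePoint.continuous_coe.continuousAt.preimage_mem_nhds (hU.mem_nhds hwU)) ?_
    filter_upwards [Metric.ball_mem_nhds w (half_pos hδ)] with y hy
    rwa [Metric.mem_ball, dist_comm, dist_eq_norm] at hy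
  have himg := (isOpenMap_iterate (hf.isOpenMap hp1) n).image_mem_nhds hV
  rw [← hg_def, hw] at himg
  -- The points `f (k / λ^j)` tend to `0`, so one of them is the `n`-th image of some `y` close to
  -- `w`. After `j` more steps `y` reaches `f k`, while the orbit of `w` rests at `0`.
  obtain ⟨j, y, ⟨hyU, hyδ⟩, hy⟩ := ((hf.tendsto_map_div hp1 k).eventually himg).exists
  have h1 := hequi y hyU ((chordalDist_coe_le w y).trans_lt (by linarith)) (j + n)
  rw [sphereMap_iterate_coe, sphereMap_iterate_coe, Function.iterate_add_apply,
    Function.iterate_add_apply _ j n y, ← hg_def, hw, hy, Function.iterate_fixed hg0,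
    hf.iterate_map_div hp1] at h1
  exact lt_irrefl _ h1

theorem IsPoincareFunction.zero_mem_of_juliaSet_subset {p : ℝ[X]} {f : ℂ → ℂ}
    (hf : IsPoincareFunction p f) (hp1 : 1 < (derivative p).eval 0) {S : Set ℂ} (hS : IsClosed S)
    (hmul : ∀ t : ℝ, 0 ≤ t → ∀ s ∈ S, (t : ℂ) * s ∈ S) (hJ : juliaSet p ⊆ (↑) '' S) {z : ℂ}
    (hz : f z = 0) : z ∈ S := by
  refine hS.mem_of_tendsto (hf.tendsto_pow_mul_map_div hp1 z) (Eventually.of_forall fun n => ?_)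
  rw [← Complex.ofReal_pow]
  refine hmul _ (by positivity) _ ?_
  rw [Complex.ofReal_pow]
  obtain ⟨s, hs, hs'⟩ := hJ (hf.mem_juliaSet_of_iterate_eq_zero hp1
    ((hf.iterate_map_div hp1 n z).trans hz))
  rwa [← OnePoint.coe_injective hs']

/-! ### Reality of `f` on the real axis -/

theorem conj_aeval_eq (p : ℝ[X]) (z : ℂ) :
    (starRingEnd ℂ) (aeval z p) = aeval ((starRingEnd ℂ) z) p := by
  have := Polynomial.aeval_algHom_apply Complex.conjAe.toAlgHom z p
  simpa using this.symm

theorem im_aeval_eq_zero (p : ℝ[X]) {z : ℂ} (hz : z.im = 0) : (aeval z p).im = 0 := by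
  rw [← Complex.conj_eq_iff_im] at hz ⊢
  rw [conj_aeval_eq, hz]

theorem im_iterate_aeval_eq_zero (p : ℝ[X]) {z : ℂ} (hz : z.im = 0) (n : ℕ) :
    ((fun z : ℂ => aeval z p)^[n] z).im = 0 := by
  induction n with
  | zero => exact hz
  | succ n ih =>
    rw [Function.iterate_succ_apply']
    exact im_aeval_eq_zero p ih

theorem two_mul_abs_im_eq (z : ℂ) : 2 * |z.im| = ‖z - (starRingEnd ℂ) z‖ := by
  rw [Complex.sub_conj]
  simp

/-- Near `0` the map `p` is `μ`-Lipschitz; apply this to `z` and its conjugate, whose images are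
again conjugate. -/
theorem eventually_abs_im_aeval_le (p : ℝ[X]) (hp1 : 0 < (derivative p).eval 0) {μ : ℝ}
    (hμ : (derivative p).eval 0 < μ) : ∀ᶠ z : ℂ in 𝓝 0, |(aeval z p).im| ≤ μ * |z.im| := by
  have h1 : HasStrictDerivAt (fun z : ℂ => aeval z p) (aeval (0 : ℂ) (derivative p)) 0 :=
    p.hasStrictDerivAt_aeval 0
  have h0 : aeval (0 : ℂ) (derivative p) = (((derivative p).eval 0 : ℝ) : ℂ) := by
    have := Polynomial.aeval_algebraMap_apply ℂ (0 : ℝ) (derivative p)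
    simpa using this
  rw [h0] at h1
  lift μ to NNReal using (hp1.trans hμ).le
  obtain ⟨s, hs, hlip⟩ := h1.hasStrictFDerivAt.exists_lipschitzOnWith_of_nnnorm_lt μ (by
    rw [← NNReal.coe_lt_coe]
    simpa [abs_of_pos hp1] using hμ)
  have hs' : ∀ᶠ z : ℂ in 𝓝 0, (starRingEnd ℂ) z ∈ s :=
    Complex.continuous_conj.continuousAt.preimage_mem_nhds (by simpa using hs)
  filter_upwards [hs, hs'] with z hz hz'
  have h2 := hlip.dist_le_mul z hz _ hz'
  rw [dist_eq_norm, dist_eq_norm, ← conj_aeval_eq, ← two_mul_abs_im_eq, ← two_mul_abs_im_eq] at h2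
  linarith

theorem IsPoincareFunction.isBigO_im {p : ℝ[X]} {f : ℂ → ℂ} (hf : IsPoincareFunction p f) :
    ∃ C : ℝ, 0 ≤ C ∧ ∀ᶠ z : ℂ in 𝓝 0, z.im = 0 → |(f z).im| ≤ C * ‖z‖ ^ 2 := by
  have hd : Differentiable ℂ (dslope f 0) := fun z =>
    ((Complex.differentiableOn_dslope univ_mem).2 hf.differentiable.differentiableOn z
      (mem_univ z)).differentiableAt univ_mem
  obtain ⟨C, hC⟩ := (hd 0).hasDerivAt.isBigO_sub.bound
  refine ⟨|C|, abs_nonneg C, ?_⟩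
  filter_upwards [hC] with z hz him
  have h1 : f z - z = z * (dslope f 0 z - dslope f 0 0) := by
    have := sub_smul_dslope f 0 z
    rw [hf.map_zero, sub_zero, sub_zero, smul_eq_mul] at this
    rw [mul_sub, this, dslope_same, hf.deriv_zero, mul_one]
  have h2 : (f z).im = (f z - z).im := by simp [him]
  rw [h2, h1]
  refine (Complex.abs_im_le_norm _).trans ?_
  rw [norm_mul]
  rw [sub_zero] at hz
  nlinarith [le_abs_self C, norm_nonneg z, mul_le_mul_of_nonneg_right (le_abs_self C) (norm_nonneg z)]

/-- The Poincaré function of a real polynomial is real on the real axis. -/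
theorem IsPoincareFunction.im_eq_zero {p : ℝ[X]} {f : ℂ → ℂ}
    (hf : IsPoincareFunction p f) (hp1 : 1 < (derivative p).eval 0) {z : ℂ} (hz : z.im = 0) :
    (f z).im = 0 := by
  set l : ℝ := (derivative p).eval 0 with hl
  have hl0 : 0 < l := by linarith
  -- For real `z`, the imaginary part of `f (z / l^n)` is of order `l^(-2n)`, and each application
  -- of `p` near `0` multiplies it by at most `μ`. Since `μ < l ^ 2`, going back `k` steps gives a
  -- bound tending to `0`.
  obtain ⟨μ, hμ1, hμ2⟩ : ∃ μ, l < μ ∧ μ < l ^ 2 := exists_between (by nlinarith)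
  have hμ0 : 0 < μ := by linarith
  obtain ⟨C, hC0, hC⟩ := hf.isBigO_im
  have hdiv := tendsto_div_ofReal_pow hp1 z
  have him : ∀ n : ℕ, (z / (l : ℂ) ^ n).im = 0 := fun n => by
    rw [← Complex.ofReal_pow, Complex.div_ofReal_im, hz, zero_div]
  obtain ⟨N, hN⟩ := eventually_atTop.1 ((hdiv.eventually hC).and
    ((hf.tendsto_map_div hp1 z).eventually (eventually_abs_im_aeval_le p hl0 hμ1)))
  have hstep : ∀ k : ℕ, |(f (z / (l : ℂ) ^ N)).im| ≤ μ ^ k * |(f (z / (l : ℂ) ^ (N + k))).im| := by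
    intro k
    induction k with
    | zero => simp
    | succ k ih =>
      refine ih.trans ?_
      have h1 := (hN (N + (k + 1)) (by omega)).2
      rw [← hf.map_mul, ← hl] at h1
      have h2 : (l : ℂ) * (z / (l : ℂ) ^ (N + (k + 1))) = z / (l : ℂ) ^ (N + k) := by
        have : (l : ℂ) ≠ 0 := by exact_mod_cast hl0.ne'
        rw [← add_assoc, pow_succ]
        field_simp
      rw [h2] at h1
      calc _ ≤ μ ^ k * (μ * |(f (z / (l : ℂ) ^ (N + (k + 1)))).im|) := by gcongr
        _ = _ := by ring
  have hbound : ∀ k : ℕ, |(f (z / (l : ℂ) ^ N)).im| ≤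
      (μ / l ^ 2) ^ k * (C * (‖z‖ / l ^ N) ^ 2) := by
    intro k
    refine (hstep k).trans ?_
    have h1 := (hN (N + k) (by omega)).1 (him _)
    rw [norm_div, norm_pow, Complex.norm_real, Real.norm_of_nonneg hl0.le] at h1
    calc _ ≤ μ ^ k * (C * (‖z‖ / l ^ (N + k)) ^ 2) := by gcongr
      _ = _ := by rw [pow_add, div_pow μ, ← pow_mul, mul_comm 2 k, pow_mul]; field_simp
  have hlim : Tendsto (fun k : ℕ => (μ / l ^ 2) ^ k * (C * (‖z‖ / l ^ N) ^ 2)) atTop (𝓝 0) := by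
    have := (tendsto_pow_atTop_nhds_zero_of_lt_one (by positivity : 0 ≤ μ / l ^ 2)
      ((div_lt_one (by positivity)).2 hμ2)).mul_const (C * (‖z‖ / l ^ N) ^ 2)
    rwa [zero_mul] at this
  have hzero : (f (z / (l : ℂ) ^ N)).im = 0 :=
    abs_nonpos_iff.1 (ge_of_tendsto' hlim hbound)
  rw [← hf.iterate_map_div hp1 N z]
  exact im_iterate_aeval_eq_zero p hzero N

/-! ### Growth of `f` and omitted values -/

/-- An entire function without zeros is the exponential of an entire function. -/
theorem exists_entire_log {h : ℂ → ℂ} (hd : Differentiable ℂ h) (h0 : ∀ z, h z ≠ 0) :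
    ∃ q : ℂ → ℂ, Differentiable ℂ q ∧ ∀ z, h z = Complex.exp (q z) := by
  have hdd : Differentiable ℂ (deriv h) := by
    have := (hd.contDiff (n := 2)).differentiable_deriv_two
    exact this
  obtain ⟨q, hq0, hq⟩ := ((hdd.div hd h0).isExactOn_univ).with_val_at 0 (Complex.log (h 0))
  have hqd : Differentiable ℂ q := fun z => (hq z (mem_univ z)).differentiableAt
  refine ⟨q, hqd, fun z => ?_⟩
  have hder : ∀ z, HasDerivAt (fun z => h z * Complex.exp (-q z)) 0 z := by
    intro z
    have h1 := (hd z).hasDerivAt.mul (hq z (mem_univ z)).neg.cexp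
    refine h1.congr_deriv ?_
    have := h0 z
    simp only [Pi.div_apply, Pi.neg_apply]
    field_simp
    ring
  have h2 := is_const_of_deriv_eq_zero (fun z => (hder z).differentiableAt)
    (fun z => (hder z).deriv) z 0
  simp only [hq0] at h2
  rw [Complex.exp_neg (Complex.log (h 0)), Complex.exp_log (h0 0), mul_inv_cancel₀ (h0 0),
    Complex.exp_neg] at h2
  field_simp at h2
  exact h2

/-- An entire function whose real part is at most of polynomial growth is a polynomial. -/
theorem exists_polynomial_of_re_le {q : ℂ → ℂ} (hq : Differentiable ℂ q) {l D d : ℝ} (hl : 1 < l)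
    (hD : 0 < D) (hd : 1 ≤ d) (h : ∀ (k : ℕ) (z : ℂ), ‖z‖ ≤ l ^ k → (q z).re ≤ D * d ^ k) :
    ∃ Q : ℂ[X], ∀ z, q z = Q.eval z := by
  obtain ⟨N₀, hN₀⟩ : ∃ N : ℕ, d < l ^ N := pow_unbounded_of_one_lt d hl
  have hzero : ∀ N, N₀ ≤ N → iteratedDeriv N q 0 = 0 := by
    intro N hN
    have hdN : d < l ^ N := hN₀.trans_le (pow_le_pow_right₀ hl.le hN)
    -- Borel–Carathéodory on the disc of radius `l ^ k` bounds `q` on the circle of half that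
    -- radius; Cauchy's estimate there gives a bound that decays in `k` as soon as `d < l ^ N`.
    have hb : ∀ k : ℕ, ‖iteratedDeriv N q 0‖ ≤
        (d / l ^ N) ^ k * (N.factorial * (2 * D + 3 * ‖q 0‖) * 2 ^ N) := by
      intro k
      have hlk : 0 < l ^ k := by positivity
      have hdk : 1 ≤ d ^ k := one_le_pow₀ hd
      have h1 := Complex.norm_iteratedDeriv_le_of_forall_mem_sphere_norm_le
        (C := 2 * (D * d ^ k) + 3 * ‖q 0‖) N (half_pos hlk)
        (hq.diffContOnCl (s := Metric.ball 0 (l ^ k / 2))) (fun z hz => by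
          have hz' : ‖z‖ = l ^ k / 2 := by simpa using hz
          have := Complex.borelCaratheodory (M := D * d ^ k) (by positivity) hq.differentiableOn
            (fun u hu => h k u (by simpa using (Metric.mem_ball.1 hu).le)) hlk
            (z := z) (by rw [mem_ball_zero_iff, hz']; linarith)
          refine this.trans (le_of_eq ?_)
          rw [hz']
          field_simp
          ring)
      refine h1.trans ?_
      calc _ ≤ N.factorial * ((2 * D + 3 * ‖q 0‖) * d ^ k) / (l ^ k / 2) ^ N := by
            gcongr
            nlinarith [norm_nonneg (q 0)]
        _ = _ := by
            rw [div_pow, div_pow, ← pow_mul, ← pow_mul, mul_comm N k]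
            field_simp
    have hlim := (tendsto_pow_atTop_nhds_zero_of_lt_one (by positivity : 0 ≤ d / l ^ N)
      ((div_lt_one (by positivity)).2 hdN)).mul_const
        (N.factorial * (2 * D + 3 * ‖q 0‖) * 2 ^ N)
    rw [zero_mul] at hlim
    exact norm_le_zero_iff.1 (ge_of_tendsto' hlim hb)
  refine ⟨∑ N ∈ Finset.range N₀, C ((N.factorial : ℂ)⁻¹ * iteratedDeriv N q 0) * X ^ N,
    fun z => ?_⟩
  rw [← Complex.taylorSeries_eq_of_entire' 0 z hq, tsum_eq_sum (s := Finset.range N₀)]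
  · simp [eval_finsetSum]
  · intro N hN
    rw [hzero N (by simpa using hN)]
    simp

theorem exists_norm_eval_le_mul_max_pow (P : ℂ[X]) :
    ∃ A : ℝ, 1 ≤ A ∧ ∀ z : ℂ, ‖P.eval z‖ ≤ A * max 1 ‖z‖ ^ P.natDegree := by
  refine ⟨1 + ∑ i ∈ Finset.range (P.natDegree + 1), ‖P.coeff i‖,
    le_add_of_nonneg_right (Finset.sum_nonneg fun _ _ => norm_nonneg _), fun z => ?_⟩
  rw [eval_eq_sum_range]
  have h1 : (1 : ℝ) ≤ max 1 ‖z‖ := le_max_left _ _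
  calc _ ≤ ∑ i ∈ Finset.range (P.natDegree + 1), ‖P.coeff i * z ^ i‖ := norm_sum_le _ _
    _ ≤ ∑ i ∈ Finset.range (P.natDegree + 1), ‖P.coeff i‖ * max 1 ‖z‖ ^ P.natDegree := by
      refine Finset.sum_le_sum fun i hi => ?_
      rw [norm_mul, norm_pow]
      gcongr
      calc ‖z‖ ^ i ≤ max 1 ‖z‖ ^ i := by gcongr; exact le_max_right _ _
        _ ≤ _ := pow_le_pow_right₀ h1 (by simpa [Nat.lt_succ_iff] using hi)
    _ ≤ _ := by
      rw [← Finset.sum_mul]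
      gcongr
      linarith

/-- A continuous solution of `f (l z) = P (f z)` has finite order of growth. -/
theorem exists_norm_le_pow_pow {P : ℂ[X]} (hd : 2 ≤ P.natDegree) {l : ℝ} (hl : 1 < l) {f : ℂ → ℂ}
    (hf : Continuous f) (hmul : ∀ z, f (l * z) = P.eval (f z)) :
    ∃ B : ℝ, 1 ≤ B ∧ ∀ (k : ℕ) (z : ℂ), ‖z‖ ≤ l ^ k → ‖f z‖ ≤ B ^ P.natDegree ^ k := by
  obtain ⟨A, hA1, hA⟩ := exists_norm_eval_le_mul_max_pow P
  obtain ⟨M, hM⟩ := (isCompact_closedBall (0 : ℂ) 1).exists_bound_of_continuousOn hf.continuousOn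
  have hB : 1 ≤ A * max 1 M := by nlinarith [le_max_left 1 M]
  -- The extra factor `A` on the left closes the induction: the step produces `A ^ 2`, which is at
  -- most `A ^ d` because `d ≥ 2`.
  have key : ∀ (k : ℕ) (z : ℂ), ‖z‖ ≤ l ^ k →
      A * max 1 ‖f z‖ ≤ (A * max 1 M) ^ P.natDegree ^ k := by
    intro k
    induction k with
    | zero =>
      intro z hz
      rw [pow_zero, pow_one]
      have := hM z (by simpa using hz)
      gcongr
    | succ k ih =>
      intro z hz
      have hl0 : (l : ℂ) ≠ 0 := by exact_mod_cast (by linarith)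
      have hu : ‖z / l‖ ≤ l ^ k := by
        rw [norm_div, Complex.norm_real, Real.norm_of_nonneg (by linarith), div_le_iff₀ (by linarith)]
        rwa [pow_succ] at hz
      have h1 := ih _ hu
      have h2 : f z = P.eval (f (z / l)) := by
        rw [← hmul]
        congr 1
        field_simp
      have h3 : 1 ≤ max 1 ‖f (z / l)‖ := le_max_left _ _
      set m := max 1 ‖f (z / l)‖
      have h4 : max 1 ‖f z‖ ≤ A * m ^ P.natDegree := by
        refine max_le ?_ (h2 ▸ hA _)
        nlinarith [one_le_pow₀ h3 (n := P.natDegree)]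
      calc A * max 1 ‖f z‖ ≤ A * (A * m ^ P.natDegree) := by gcongr
        _ = A ^ 2 * m ^ P.natDegree := by ring
        _ ≤ A ^ P.natDegree * m ^ P.natDegree := by gcongr
        _ = (A * m) ^ P.natDegree := by rw [mul_pow]
        _ ≤ ((A * max 1 M) ^ P.natDegree ^ k) ^ P.natDegree := by gcongr
        _ = _ := by rw [← pow_mul, pow_succ]
  refine ⟨_, hB, fun k z hz => le_trans ?_ (key k z hz)⟩
  nlinarith [le_max_right 1 ‖f z‖, le_max_left 1 ‖f z‖]

/-- A point different from `0` some iterate of which is `0` is a value of every nonconstant entire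
solution of `f (l z) = P (f z)`. -/
theorem exists_map_eq_of_iterate_eq_zero {P : ℂ[X]} (hd : 2 ≤ P.natDegree) {l : ℝ} (hl : 1 < l)
    {f : ℂ → ℂ} (hf : Differentiable ℂ f) (hconst : ∀ c, ¬ ∀ z, f z = c)
    (hmul : ∀ z, f (l * z) = P.eval (f z)) {n : ℕ} {w : ℂ} (hw0 : w ≠ 0)
    (hw : (fun z => P.eval z)^[n] w = 0) : ∃ z, f z = w := by
  by_contra! homit
  obtain ⟨q, hq, hexp⟩ := exists_entire_log (hf.sub_const w) fun z => sub_ne_zero.2 (homit z)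
  obtain ⟨B, hB, hgrowth⟩ := exists_norm_le_pow_pow hd hl hf.continuous hmul
  have hB1 : 1 ≤ B * (1 + ‖w‖) := by nlinarith [norm_nonneg w]
  obtain ⟨Q, hQ⟩ := exists_polynomial_of_re_le hq (D := Real.log (B * (1 + ‖w‖)) + 1)
    (d := P.natDegree) hl (by linarith [Real.log_nonneg hB1]) (by exact_mod_cast (by omega))
    (fun k z hz => by
      have h1 : Real.exp (q z).re ≤ (B * (1 + ‖w‖)) ^ P.natDegree ^ k := by
        rw [← Complex.norm_exp, ← hexp]
        have h2 := hgrowth k z hz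
        have h3 : 1 ≤ B ^ P.natDegree ^ k := one_le_pow₀ hB
        have h4 : 1 + ‖w‖ ≤ (1 + ‖w‖) ^ P.natDegree ^ k :=
          le_self_pow₀ (by linarith [norm_nonneg w]) (by positivity)
        rw [mul_pow]
        calc ‖f z - w‖ ≤ ‖f z‖ + ‖w‖ := norm_sub_le _ _
          _ ≤ B ^ P.natDegree ^ k * (1 + ‖w‖) := by nlinarith [norm_nonneg w]
          _ ≤ _ := by gcongr
      rw [← Real.le_log_iff_exp_le (by positivity), Real.log_pow] at h1
      push_cast at h1
      nlinarith [one_le_pow₀ (show (1 : ℝ) ≤ P.natDegree by exact_mod_cast (by omega)) (n := k)])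
  -- A preimage `v` of `w` differs from `w`, since `w` is not fixed. As `Q` is nonconstant, `w + exp
  -- Q` takes the value `v`, and then the functional equation makes `f` take the value `w`.
  obtain ⟨v, hv⟩ := IsAlgClosed.exists_root (P - C w) (by
    rw [degree_sub_C (natDegree_pos_iff_degree_pos.1 (by omega))]
    exact (natDegree_pos_iff_degree_pos.1 (by omega)).ne')
  have hv' : P.eval v = w := by simpa [sub_eq_zero] using hv
  have hvw : v - w ≠ 0 := by
    rw [sub_ne_zero]
    rintro rfl
    rw [Function.iterate_fixed hv'] at hw
    exact hw0 hw
  obtain ⟨z, hz⟩ := IsAlgClosed.exists_root (Q - C (Complex.log (v - w))) (by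
    intro h0
    have hQc : ∀ z, Q.eval z = (Q - C (Complex.log (v - w))).coeff 0 + Complex.log (v - w) := by
      intro z
      have h1 : (Q - C (Complex.log (v - w))).eval z = (Q - C (Complex.log (v - w))).coeff 0 := by
        conv_lhs => rw [eq_C_of_degree_eq_zero h0, eval_C]
      rw [← h1]
      simp
    refine hconst (w + Complex.exp (q 0)) fun z => ?_
    rw [hQ 0, hQc 0, ← hQc z, ← hQ z, ← hexp z]
    ring)
  have hz' : q z = Complex.log (v - w) := by rw [hQ]; simpa [sub_eq_zero] using hz
  have hfz : f z = v := by
    have := hexp z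
    rw [hz', Complex.exp_log hvw] at this
    exact sub_left_injective this
  exact homit (l * z) (by rw [hmul, hfz, hv'])

/-! ### Behaviour of `f` on the positive real axis -/

theorem lt_of_forall_ne_on_Ioi {G : ℝ → ℝ} (hG : Continuous G) {c : ℝ} (hne : ∀ t, 0 < t → G t ≠ c)
    {s : ℝ} (hs : 0 < s) (hsc : G s < c) {t : ℝ} (ht : 0 < t) : G t < c := by
  by_contra! h
  obtain ⟨u, hu, huc⟩ := (isPreconnected_Ioi (a := (0 : ℝ))).intermediate_value hs ht
    hG.continuousOn ⟨hsc.le, h⟩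
  exact hne u hu huc

theorem norm_ofReal_sub_eq {r : ℂ} (hr : r.im = 0) (x : ℝ) : ‖(x : ℂ) - r‖ = |x - r.re| := by
  have h1 : ((x : ℂ) - r).im = 0 := by simp [hr]
  rw [← Complex.abs_re_eq_norm.2 h1]
  simp

/-- With midpoint `m` and half-length `h`, the product of the distances to a root outside the
interval is `(m - r)² - h²`, and `|m - r| ≤ m + R`. -/
theorem norm_mul_norm_le_of_notMem_Icc {a b R : ℝ} (ha : 0 < a) (hab : a < b) {r : ℂ}
    (hr : r.im = 0) (hrR : ‖r‖ ≤ R) (hrab : r.re ∉ Icc a b) :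
    ‖(a : ℂ) - r‖ * ‖(b : ℂ) - r‖ ≤ (1 - (((b - a) / 2) / ((a + b) / 2 + R)) ^ 2) *
      (‖(((a + b) / 2 : ℝ) : ℂ) - r‖ * ‖(((a + b) / 2 : ℝ) : ℂ) - r‖) := by
  rw [norm_ofReal_sub_eq hr, norm_ofReal_sub_eq hr, norm_ofReal_sub_eq hr, ← abs_mul,
    abs_mul_abs_self]
  have hR : 0 ≤ R := (norm_nonneg _).trans hrR
  have hr1 := abs_le.1 ((Complex.abs_re_le_norm r).trans hrR)
  have hpos : 0 ≤ (a - r.re) * (b - r.re) := by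
    rw [mem_Icc, not_and_or, not_le, not_le] at hrab
    rcases hrab with h | h
    · exact mul_nonneg (by linarith) (by linarith)
    · exact mul_nonneg_of_nonpos_of_nonpos (by linarith) (by linarith)
  rw [abs_of_nonneg hpos]
  set m := (a + b) / 2 with hm
  set h := (b - a) / 2 with hh
  have hm0 : 0 < m + R := by linarith
  have h1 : (h / (m + R)) ^ 2 * ((m - r.re) * (m - r.re)) ≤ h ^ 2 := by
    have h2 : (m - r.re) * (m - r.re) ≤ (m + R) ^ 2 := by
      rw [← sq]
      exact sq_le_sq' (by linarith) (by linarith)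
    calc _ ≤ (h / (m + R)) ^ 2 * (m + R) ^ 2 := by gcongr
      _ = _ := by field_simp
  have h3 : (a - r.re) * (b - r.re) = (m - r.re) * (m - r.re) - h ^ 2 := by
    rw [hm, hh]; ring
  linarith

theorem aeval_eq_eval_map (p : ℝ[X]) :
    (fun z : ℂ => aeval z p) = fun z => (p.map (algebraMap ℝ ℂ)).eval z := by
  ext z
  rw [eval_map_algebraMap]

theorem IsPoincareFunction.map_ofReal {p : ℝ[X]} {f : ℂ → ℂ} (hf : IsPoincareFunction p f)
    (hp1 : 1 < (derivative p).eval 0) (t : ℝ) : f t = ((f t).re : ℂ) :=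
  Complex.ext rfl (hf.im_eq_zero hp1 (Complex.ofReal_im t))

theorem IsPoincareFunction.tendsto_re {p : ℝ[X]} {f : ℂ → ℂ} (hf : IsPoincareFunction p f)
    (hp1 : 1 < (derivative p).eval 0) (t : ℝ) :
    Tendsto (fun n : ℕ => ((derivative p).eval 0) ^ n *
      (f ((t / ((derivative p).eval 0) ^ n : ℝ) : ℂ)).re) atTop (𝓝 t) := by
  have h := (Complex.continuous_re.tendsto _).comp (hf.tendsto_pow_mul_map_div hp1 t)
  refine h.congr fun n => ?_
  simp only [Function.comp_apply]
  rw [← Complex.ofReal_pow, Complex.re_ofReal_mul, Complex.ofReal_div]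

/-- If the positive real axis contains no zeros of `f`, then `f` is positive there. -/
theorem IsPoincareFunction.re_pos {p : ℝ[X]} {f : ℂ → ℂ} (hf : IsPoincareFunction p f)
    (hp1 : 1 < (derivative p).eval 0) (hne : ∀ t : ℝ, 0 < t → f t ≠ 0) {t : ℝ} (ht : 0 < t) :
    0 < (f t).re := by
  have hcont : Continuous fun t : ℝ => -(f t).re :=
    (Complex.continuous_re.comp (hf.differentiable.continuous.comp Complex.continuous_ofReal)).neg
  obtain ⟨n, hn⟩ := ((hf.tendsto_re hp1 t).eventually (lt_mem_nhds ht)).exists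
  have hl : 0 < ((derivative p).eval 0) ^ n := by positivity
  have := lt_of_forall_ne_on_Ioi hcont (c := 0) (fun u hu h => hne u hu (by
    rw [hf.map_ofReal hp1, neg_eq_zero.1 h, Complex.ofReal_zero])) (div_pos ht hl)
    (neg_lt_zero.2 (pos_of_mul_pos_right hn hl.le)) ht
  linarith

theorem IsPoincareFunction.tendsto_re_div {p : ℝ[X]} {f : ℂ → ℂ} (hf : IsPoincareFunction p f)
    (hp1 : 1 < (derivative p).eval 0) (t : ℝ) :
    Tendsto (fun n : ℕ => (f ((t / ((derivative p).eval 0) ^ n : ℝ) : ℂ)).re) atTop (𝓝 0) := by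
  have h := (Complex.continuous_re.tendsto _).comp (hf.tendsto_map_div hp1 t)
  rw [Complex.zero_re] at h
  refine h.congr fun n => ?_
  simp

theorem IsPoincareFunction.iterate_ofReal_re {p : ℝ[X]} {f : ℂ → ℂ} (hf : IsPoincareFunction p f)
    (hp1 : 1 < (derivative p).eval 0) (n : ℕ) (t : ℝ) :
    (fun z : ℂ => aeval z p)^[n] ((f t).re : ℂ) =
      ((f ((((derivative p).eval 0) ^ n * t : ℝ) : ℂ)).re : ℂ) := by
  rw [← hf.map_ofReal hp1, ← hf.map_ofReal hp1, ← hf.map_pow_mul]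
  simp

/-- If `f` has no zeros on the positive real axis and is bounded there, then distinct values of `f`
cannot both have orbits bounded away from `0`. -/
theorem IsPoincareFunction.tendsto_re_mul_re_zero {p : ℝ[X]} {f : ℂ → ℂ}
    (hf : IsPoincareFunction p f) (hp1 : 1 < (derivative p).eval 0)
    (hd : 2 ≤ p.natDegree) {κ R : ℝ} (hκ : 1 < κ) (hR : 0 < R)
    (hesc : ∀ z : ℂ, R ≤ ‖z‖ → κ * ‖z‖ ≤ ‖aeval z p‖) (hp0 : aeval (0 : ℂ) p = 0)
    (hreal : ∀ (n : ℕ) (r : ℂ), (fun z => aeval z p)^[n] r = 0 → r.im = 0)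
    (hne : ∀ t : ℝ, 0 < t → f t ≠ 0) {M : ℝ} (hM : ∀ t : ℝ, 0 < t → (f t).re ≤ M) {s t : ℝ}
    (hs : 0 < s) (ht : 0 < t) (hst : (f s).re < (f t).re) :
    Tendsto (fun n : ℕ => (f ((((derivative p).eval 0) ^ n * s : ℝ) : ℂ)).re *
      (f ((((derivative p).eval 0) ^ n * t : ℝ) : ℂ)).re) atTop (𝓝 0) := by
  have hl : 0 < (derivative p).eval 0 := by linarith
  have hpos : ∀ t : ℝ, 0 < t → 0 < (f t).re := fun t ht => hf.re_pos hp1 hne ht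
  have hcont : Continuous fun t : ℝ => (f t).re :=
    Complex.continuous_re.comp (hf.differentiable.continuous.comp Complex.continuous_ofReal)
  have hIcc : ∀ x ∈ Icc (f s).re (f t).re, ∃ u : ℝ, 0 < u ∧ (f u).re = x := fun x hx =>
    (isPreconnected_Ioi (a := (0 : ℝ))).intermediate_value hs ht hcont.continuousOn hx
  have hK : ∀ u : ℝ, 0 < u → ((f u).re : ℂ) ∈ boundedOrbits (fun z => aeval z p) R := by
    intro u hu
    refine mem_boundedOrbits_of_bounded hκ hR hesc (B := M) (Eventually.of_forall fun n => ?_).frequently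
    rw [hf.iterate_ofReal_re hp1, Complex.norm_real,
      Real.norm_of_nonneg (hpos _ (by positivity)).le]
    exact hM _ (by positivity)
  -- A root in this interval would be some `f u` with `u > 0`, making `λ^n u` a positive zero of
  -- `f`.
  have hroot : ∀ (n : ℕ) (r : ℂ), (fun z => aeval z p)^[n] r = 0 →
      r.re ∉ Icc (f s).re (f t).re := by
    intro n r hr hmem
    obtain ⟨u, hu, hur⟩ := hIcc _ hmem
    have h1 : r = ((f u).re : ℂ) := Complex.ext hur.symm (hreal n r hr)
    rw [h1, hf.iterate_ofReal_re hp1, ← hf.map_ofReal hp1] at hr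
    exact hne _ (by positivity) hr
  obtain ⟨u, hu, hum⟩ := hIcc (((f s).re + (f t).re) / 2) ⟨by linarith, by linarith⟩
  have hs0 := hpos s hs
  have hq : 0 < ((f t).re - (f s).re) / 2 / (((f s).re + (f t).re) / 2 + R) :=
    div_pos (by linarith) (by linarith)
  have hq1 : ((f t).re - (f s).re) / 2 / (((f s).re + (f t).re) / 2 + R) ≤ 1 :=
    (div_le_one (by linarith)).2 (by linarith)
  have hmK := hK u hu
  rw [hum, aeval_eq_eval_map] at hmK
  have key := tendsto_norm_iterate_eval_mul_zero (P := p.map (algebraMap ℝ ℂ)) (by simpa using hd)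
    (a := ((f s).re : ℂ)) (b := ((f t).re : ℂ)) (R := R)
    (m := ((((f s).re + (f t).re) / 2 : ℝ) : ℂ))
    (q := 1 - (((f t).re - (f s).re) / 2 / (((f s).re + (f t).re) / 2 + R)) ^ 2)
    (by nlinarith) (by nlinarith)
    (fun n r hr => by
      rw [← aeval_eq_eval_map] at hr
      exact norm_mul_norm_le_of_notMem_Icc hs0 hst (hreal n r hr)
        (norm_le_of_iterate_eq_zero hκ hR hesc hp0 hr) (hroot n r hr)) hmK
  refine key.congr fun n => ?_
  rw [← aeval_eq_eval_map, hf.iterate_ofReal_re hp1, hf.iterate_ofReal_re hp1, Complex.norm_real,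
    Complex.norm_real, Real.norm_of_nonneg (hpos _ (by positivity)).le,
    Real.norm_of_nonneg (hpos _ (by positivity)).le]

/-- If all iterated preimages of `0` are real and `f` has no zeros on the positive real axis, then
`f` is unbounded there. -/
theorem IsPoincareFunction.exists_lt_re {p : ℝ[X]} {f : ℂ → ℂ}
    (hf : IsPoincareFunction p f) (hp1 : 1 < (derivative p).eval 0)
    (hd : 2 ≤ p.natDegree) {κ R : ℝ} (hκ : 1 < κ) (hR : 0 < R)
    (hesc : ∀ z : ℂ, R ≤ ‖z‖ → κ * ‖z‖ ≤ ‖aeval z p‖) (hp0 : aeval (0 : ℂ) p = 0)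
    (hreal : ∀ (n : ℕ) (r : ℂ), (fun z => aeval z p)^[n] r = 0 → r.im = 0)
    (hne : ∀ t : ℝ, 0 < t → f t ≠ 0) (M : ℝ) : ∃ t : ℝ, 0 < t ∧ M < (f t).re := by
  by_contra! hM
  have hpos : ∀ t : ℝ, 0 < t → 0 < (f t).re := fun t ht => hf.re_pos hp1 hne ht
  have hcont : Continuous fun t : ℝ => (f t).re :=
    Complex.continuous_re.comp (hf.differentiable.continuous.comp Complex.continuous_ofReal)
  have hlim := fun {s t : ℝ} => hf.tendsto_re_mul_re_zero (s := s) (t := t) hp1 hd hκ hR hesc hp0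
    hreal hne hM
  have hiter := hf.iterate_ofReal_re hp1
  have hdiv := hf.tendsto_re_div hp1
  have hdiv' := hf.tendsto_re hp1
  set l := (derivative p).eval 0
  have hl : 0 < l := by linarith
  -- Boundedness would force the product in `hlim` to tend to `0`. Two positive values whose orbits
  -- stay away from `0` refute this: if some `f t` is fixed by `p`, take it and a smaller value
  -- whose orbit lands on it; otherwise `f (l t) > f t` throughout, and orbits of values increase.
  by_cases hfix : ∃ t : ℝ, 0 < t ∧ (f ((l * t : ℝ) : ℂ)).re = (f t).re
  · obtain ⟨t, ht, hfix⟩ := hfix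
    have hfixn : ∀ n : ℕ, (f ((l ^ n * t : ℝ) : ℂ)).re = (f t).re := by
      intro n
      have h1 := hiter 1 t
      rw [pow_one, hfix, Function.iterate_one] at h1
      have h2 := hiter n t
      rw [Function.iterate_fixed h1] at h2
      exact_mod_cast h2.symm
    obtain ⟨k, hk⟩ := ((hdiv t).eventually (gt_mem_nhds (hpos t ht))).exists
    have h1 := hlim (s := t / l ^ k) (by positivity) ht hk
    have h2 : ∀ᶠ n in atTop, (f ((l ^ n * (t / l ^ k) : ℝ) : ℂ)).re *
        (f ((l ^ n * t : ℝ) : ℂ)).re = (f t).re * (f t).re := by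
      filter_upwards [eventually_ge_atTop k] with n hn
      obtain ⟨j, rfl⟩ := Nat.exists_eq_add_of_le hn
      rw [hfixn, show l ^ (k + j) * (t / l ^ k) = l ^ j * t by rw [pow_add]; field_simp, hfixn]
    have h3 := tendsto_nhds_unique h1 (tendsto_const_nhds.congr' (h2.mono fun n hn => hn.symm))
    have := mul_pos (hpos t ht) (hpos t ht)
    linarith
  · push Not at hfix
    have hgt : ∀ t : ℝ, 0 < t → (f t).re < (f ((l * t : ℝ) : ℂ)).re := by
      intro t ht
      -- The linearization gives `f (l u) > f u` at some small `u`; since equality never occurs, the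
      -- inequality spreads to the whole half-line.
      have h1 : Tendsto (fun n : ℕ => l ^ n * (f ((l * t / l ^ n : ℝ) : ℂ)).re -
          l ^ n * (f ((t / l ^ n : ℝ) : ℂ)).re) atTop (𝓝 (l * t - t)) := (hdiv' _).sub (hdiv' _)
      obtain ⟨n, hn⟩ := (h1.eventually (lt_mem_nhds (by nlinarith : 0 < l * t - t))).exists
      have hln : 0 < l ^ n := by positivity
      have h2 : Continuous fun t : ℝ => (f t).re - (f ((l * t : ℝ) : ℂ)).re :=
        hcont.sub (hcont.comp (continuous_const.mul continuous_id))
      have h3 := lt_of_forall_ne_on_Ioi h2 (c := 0) (s := t / l ^ n)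
        (fun u hu h => hfix u hu (by linarith)) (by positivity) (by
          rw [← mul_div_assoc]
          have : 0 < l ^ n * ((f ((l * t / l ^ n : ℝ) : ℂ)).re - (f ((t / l ^ n : ℝ) : ℂ)).re) := by
            linarith
          linarith [pos_of_mul_pos_right this hln.le]) ht
      linarith
    have hgtn : ∀ (t : ℝ) (n : ℕ), 0 < t → (f t).re ≤ (f ((l ^ n * t : ℝ) : ℂ)).re := by
      intro t n ht
      induction n with
      | zero => simp
      | succ n ih =>
        have := hgt (l ^ n * t) (by positivity)
        rw [pow_succ', mul_assoc]
        linarith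
    have h1 := hlim (s := 1) (t := l * 1) one_pos (by positivity) (hgt 1 one_pos)
    have h2 := ge_of_tendsto' h1 fun n => mul_le_mul (hgtn 1 n one_pos)
      (hgtn (l * 1) n (by positivity)) (hpos _ (by positivity)).le (hpos _ (by positivity)).le
    have := mul_pos (hpos 1 one_pos) (hpos (l * 1) (by positivity))
    linarith

/-! ### From the zeros of `f` to the Julia set -/

theorem IsPoincareFunction.exists_map_eq {p : ℝ[X]} {f : ℂ → ℂ} (hf : IsPoincareFunction p f)
    (hp1 : 1 < (derivative p).eval 0) (hd : 2 ≤ p.natDegree) {n : ℕ} {w : ℂ}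
    (hw : (fun z => aeval z p)^[n] w = 0) : ∃ z, f z = w := by
  rcases eq_or_ne w 0 with rfl | hw0
  · exact ⟨0, hf.map_zero⟩
  · refine exists_map_eq_of_iterate_eq_zero (P := p.map (algebraMap ℝ ℂ)) (n := n)
      (by simpa using hd) hp1 hf.differentiable hf.not_const (fun z => ?_) hw0 ?_
    · rw [eval_map_algebraMap, hf.map_mul]
    · rwa [aeval_eq_eval_map] at hw

theorem exists_escape {p : ℝ[X]} (hp0 : p.eval 0 = 0) (hd : 2 ≤ p.natDegree) :
    ∃ R : ℝ, 0 < R ∧ ∀ z : ℂ, R ≤ ‖z‖ → 2 * ‖z‖ ≤ ‖aeval z p‖ := by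
  simp only [← eval_map_algebraMap]
  refine exists_escape_radius ?_ (by simpa using hd)
  rw [← map_zero (algebraMap ℝ ℂ), eval_map_apply, hp0]

theorem IsPoincareFunction.im_eq_zero_of_iterate_eq_zero {p : ℝ[X]} {f : ℂ → ℂ}
    (hf : IsPoincareFunction p f) (hp1 : 1 < (derivative p).eval 0) (hd : 2 ≤ p.natDegree)
    (hzero : ∀ z, f z = 0 → z.im = 0) {n : ℕ} {w : ℂ} (hw : (fun z => aeval z p)^[n] w = 0) :
    w.im = 0 := by
  obtain ⟨z, rfl⟩ := hf.exists_map_eq hp1 hd hw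
  rw [← hf.map_pow_mul] at hw
  have h1 := hzero _ hw
  rw [← Complex.ofReal_pow, Complex.im_ofReal_mul] at h1
  exact hf.im_eq_zero hp1 ((mul_eq_zero.1 h1).resolve_left (by positivity))

/-- On the positive axis `f` is small near `0` and unbounded, so it would take the value `w > 0` at
some `u > 0`, and `λ^n u` would be a positive zero. -/
theorem IsPoincareFunction.re_nonpos_of_iterate_eq_zero {p : ℝ[X]} {f : ℂ → ℂ}
    (hf : IsPoincareFunction p f) (hp0 : p.eval 0 = 0) (hp1 : 1 < (derivative p).eval 0)
    (hd : 2 ≤ p.natDegree) (hzero : ∀ z, f z = 0 → z.im = 0)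
    (hzero' : ∀ z, f z = 0 → z.re ≤ 0) {n : ℕ} {w : ℂ}
    (hw : (fun z => aeval z p)^[n] w = 0) : w.re ≤ 0 := by
  by_contra! hpos
  have hreal := fun (n : ℕ) (r : ℂ) (hr : (fun z => aeval z p)^[n] r = 0) =>
    hf.im_eq_zero_of_iterate_eq_zero hp1 hd hzero hr
  have hne : ∀ t : ℝ, 0 < t → f t ≠ 0 := fun t ht h => ht.not_ge (by simpa using hzero' _ h)
  obtain ⟨R, hR, hesc⟩ := exists_escape hp0 hd
  have hp0' : aeval (0 : ℂ) p = 0 := by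
    have := hf.map_mul 0
    rw [mul_zero, hf.map_zero] at this
    exact this.symm
  obtain ⟨t, ht, hwt⟩ := hf.exists_lt_re hp1 hd one_lt_two hR hesc hp0' hreal hne w.re
  have hcont : Continuous fun t : ℝ => (f t).re :=
    Complex.continuous_re.comp (hf.differentiable.continuous.comp Complex.continuous_ofReal)
  obtain ⟨k, hk⟩ := ((hf.tendsto_re_div hp1 1).eventually (gt_mem_nhds hpos)).exists
  refine (lt_of_forall_ne_on_Ioi hcont (fun u hu hwu => ?_) (by positivity) hk ht).not_gt hwt
  have h1 : w = ((f u).re : ℂ) := Complex.ext hwu.symm (hreal n w hw)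
  rw [h1, hf.iterate_ofReal_re hp1, ← hf.map_ofReal hp1] at hw
  exact hne _ (by positivity) hw

/-- The Julia set of a linear expanding map is contained in `{0}`. -/
theorem juliaSet_subset_of_natDegree_lt_two {p : ℝ[X]} (hp0 : p.eval 0 = 0)
    (hp1 : 1 < (derivative p).eval 0) (hd : p.natDegree < 2) :
    juliaSet p ⊆ (↑) '' ({0} : Set ℂ) := by
  have hp : ∀ z : ℂ, aeval z p = (((derivative p).eval 0 : ℝ) : ℂ) * z := by
    intro z
    rw [← coeff_zero_eq_eval_zero] at hp0 ⊢
    rw [eq_X_add_C_of_natDegree_le_one (by omega : p.natDegree ≤ 1), hp0]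
    simp
  have hl0 : 0 < (derivative p).eval 0 := by linarith
  have hesc : ∀ z : ℂ, (1 : ℝ) ≤ ‖z‖ → (derivative p).eval 0 * ‖z‖ ≤ ‖aeval z p‖ := by
    intro z _
    rw [hp, norm_mul, Complex.norm_real, Real.norm_of_nonneg hl0.le]
  refine (juliaSet_subset_boundedOrbits hp1 one_pos hesc).trans (image_mono fun z hz => ?_)
  rw [mem_singleton_iff, ← norm_eq_zero]
  have hiter : ∀ n : ℕ, ‖(fun z : ℂ => aeval z p)^[n] z‖ = (derivative p).eval 0 ^ n * ‖z‖ := by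
    intro n
    induction n with
    | zero => simp
    | succ n ih =>
      rw [Function.iterate_succ_apply', hp, norm_mul, ih, Complex.norm_real,
        Real.norm_of_nonneg hl0.le]
      ring
  by_contra hne
  have hz0 : 0 < ‖z‖ := lt_of_le_of_ne (norm_nonneg z) (Ne.symm hne)
  obtain ⟨n, hn⟩ := (((tendsto_pow_atTop_atTop_of_one_lt hp1).atTop_mul_const
    hz0).eventually_gt_atTop 1).exists
  have h1 := hz n
  rw [hiter] at h1
  linarith

/-- The sign condition is kept conditional so that one inclusion serves both equivalences. -/
theorem IsPoincareFunction.juliaSet_subset_of_zeros_real {p : ℝ[X]} {f : ℂ → ℂ}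
    (hf : IsPoincareFunction p f) (hp0 : p.eval 0 = 0) (hp1 : 1 < (derivative p).eval 0)
    (hzero : ∀ z, f z = 0 → z.im = 0) :
    juliaSet p ⊆ (↑) '' {z : ℂ | z.im = 0 ∧ ((∀ z, f z = 0 → z.re ≤ 0) → z.re ≤ 0)} := by
  rcases lt_or_ge p.natDegree 2 with hd | hd
  · exact (juliaSet_subset_of_natDegree_lt_two hp0 hp1 hd).trans (image_mono (by simp))
  obtain ⟨R, hR, hesc⟩ := exists_escape hp0 hd
  have hP0 : (p.map (algebraMap ℝ ℂ)).eval 0 = 0 := by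
    rw [← _root_.map_zero (algebraMap ℝ ℂ), eval_map_apply, hp0]
  have hP1 : 1 < ‖(derivative (p.map (algebraMap ℝ ℂ))).eval 0‖ := by
    rw [derivative_map, ← _root_.map_zero (algebraMap ℝ ℂ), eval_map_apply, norm_algebraMap',
      Real.norm_of_nonneg (by linarith)]
    exact hp1
  have hreal : ∀ (n : ℕ) (r : ℂ),
      (fun z => (p.map (algebraMap ℝ ℂ)).eval z)^[n] r = 0 → r.im = 0 := by
    rw [← aeval_eq_eval_map]
    exact fun n r hr => hf.im_eq_zero_of_iterate_eq_zero hp1 hd hzero hr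
  refine (juliaSet_subset_boundedOrbits one_lt_two hR hesc).trans (image_mono fun z hz => ?_)
  rw [aeval_eq_eval_map] at hz
  simp only [← eval_map_algebraMap] at hesc
  have hd' : 2 ≤ (p.map (algebraMap ℝ ℂ)).natDegree := by simpa using hd
  refine ⟨im_eq_zero_of_mem_boundedOrbits hP0 hP1 hd' one_lt_two hR hesc hreal hz,
    fun hzero' => re_nonpos_of_mem_boundedOrbits hP0 hP1 hd' one_lt_two hR hesc hreal ?_ hz⟩
  rw [← aeval_eq_eval_map]
  exact fun n r hr => hf.re_nonpos_of_iterate_eq_zero hp0 hp1 hd hzero hzero' hr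

theorem mainTheorem5 (p : ℝ[X]) (hp0 : p.eval 0 = 0) (hp1 : 1 < (derivative p).eval 0)
    (f : ℂ → ℂ) (hf : IsPoincareFunction p f) :
    ((juliaSet p ⊆ (fun x : ℝ => ((x : ℂ) : OnePoint ℂ)) '' Set.Iic 0) ↔
      ∀ z : ℂ, f z = 0 → ∃ x : ℝ, x ≤ 0 ∧ z = (x : ℂ)) ∧
    ((juliaSet p ⊆ Set.range (fun x : ℝ => ((x : ℂ) : OnePoint ℂ))) ↔
      ∀ z : ℂ, f z = 0 → ∃ x : ℝ, z = (x : ℂ)) := by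
  refine ⟨⟨fun hJ z hz => ?_, fun h => ?_⟩, ⟨fun hJ z hz => ?_, fun h => ?_⟩⟩
  · have hS : IsClosed {z : ℂ | z.im = 0 ∧ z.re ≤ 0} :=
      (isClosed_eq Complex.continuous_im continuous_const).inter
        (isClosed_le Complex.continuous_re continuous_const)
    have h1 := hf.zero_mem_of_juliaSet_subset hp1 hS (fun t ht s hs => ⟨by simp [hs.1], by
        rw [Complex.re_ofReal_mul]
        exact mul_nonpos_of_nonneg_of_nonpos ht hs.2⟩) (hJ.trans (by
      rintro _ ⟨x, hx, rfl⟩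
      exact ⟨(x : ℂ), ⟨Complex.ofReal_im x, by simpa using hx⟩, rfl⟩)) hz
    exact ⟨z.re, h1.2, Complex.ext rfl h1.1⟩
  · have him : ∀ z, f z = 0 → z.im = 0 := fun z hz => by
      obtain ⟨x, _, rfl⟩ := h z hz
      exact Complex.ofReal_im x
    have hre : ∀ z, f z = 0 → z.re ≤ 0 := fun z hz => by
      obtain ⟨x, hx, rfl⟩ := h z hz
      simpa using hx
    refine (hf.juliaSet_subset_of_zeros_real hp0 hp1 him).trans ?_
    rintro _ ⟨z, ⟨hz1, hz2⟩, rfl⟩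
    exact ⟨z.re, hz2 hre, congrArg _ (Complex.ext rfl hz1.symm)⟩
  · have hS : IsClosed {z : ℂ | z.im = 0} := isClosed_eq Complex.continuous_im continuous_const
    have h1 := hf.zero_mem_of_juliaSet_subset hp1 hS (fun t _ s hs => by
        simpa using Or.inr hs) (hJ.trans (by
      rintro _ ⟨x, rfl⟩
      exact ⟨(x : ℂ), Complex.ofReal_im x, rfl⟩)) hz
    exact ⟨z.re, Complex.ext rfl h1⟩
  · have him : ∀ z, f z = 0 → z.im = 0 := fun z hz => by
      obtain ⟨x, rfl⟩ := h z hz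
      exact Complex.ofReal_im x
    refine (hf.juliaSet_subset_of_zeros_real hp0 hp1 him).trans ?_
    rintro _ ⟨z, ⟨hz1, -⟩, rfl⟩
    exact ⟨z.re, congrArg _ (Complex.ext rfl hz1.symm)⟩
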